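/- Let $n\ge 1$. For a subset $J\subseteq\{1,\dots,n\}$, an ordered set partition of $J$ is a sequence $\mathbf S=(S_1,\dots,S_k)$ of nonempty, pairwise disjoint sets (blocks) with union $J$; write $\mathrm{len}(\mathbf S)=k$. Its plate is the cone $$[\mathbf S]=\Big\{x\in\mathbb R^n:\ x_i=0\text{ for } i\notin J,\quad \sum_{i=1}^n x_i=0,\quad \sum_{i\in S_1\cup\dots\cup S_j}x_i\ge 0\text{ for } j=1,\dots,k-1\Big\}.$$ For a set $C\subseteq\mathbb R^n$ let $[C]:\mathbb R^n\to\mathbb C$ be its characteristic function, so that $[[\mathbf S]]$ is the characteristic function of the plate $[\mathbf S]$. The convolution of characteristic functions of cones is the characteristic function of their Minkowski sum: $[C_1]\bullet\cdots\bullet[C_l]=[C_1+\cdots+C_l]$. Let $J_1,\dots,J_l$ be pairwise disjoint subsets of $\{1,\dots,n\}$ with union $\{1,\dots,n\}$, let $\mathbf S_i$ be an ordered set partition of $J_i$ for $i=1,\dots,l$, and let $m=\mathrm{len}(\mathbf S_1)+\cdots+\mathrm{len}(\mathbf S_l)$. A shuffle-lumping of $\mathbf S_1,\dots,\mathbf S_l$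 is an ordered set partition $\mathbf T=(T_1,\dots,T_r)$ of $\{1,\dots,n\}$ such that every $T_p$ is a union of blocks of the $\mathbf S_i$ and such that, for each $i$, whenever $A$ precedes $B$ in $\mathbf S_i$ and $A\subseteq T_p$, $B\subseteq T_q$, one has $p<q$. Theorem. As functions on $\mathbb R^n$, $$[[\mathbf S_1]]\bullet\cdots\bullet[[\mathbf S_l]]=\sum_{\mathbf T}(-1)^{m-\mathrm{len}(\mathbf T)}\,[[\mathbf T]],$$ where $\mathbf T$ runs over all shuffle-lumpings of $\mathbf S_1,\dots,\mathbf S_l$. -/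

import Mathlib

/-- An ordered set partition of a finite set `J`: a sequence of nonempty, mutually disjoint
blocks whose union is `J`. -/
@[ext]
structure OrderedSetPartition {α : Type*} [DecidableEq α] (J : Finset α) where
  blocks : List (Finset α)
  nonempty_of_mem : ∀ B ∈ blocks, B.Nonempty
  pairwise_disjoint : blocks.Pairwise Disjoint
  union_eq : blocks.foldr (· ∪ ·) ∅ = J

namespace OrderedSetPartition

section General

variable {α : Type*} [DecidableEq α] {J : Finset α}

/-- The number of blocks. -/
def len (S : OrderedSetPartition J) : ℕ := S.blocks.length

/-- The `a`-th block (counting from `0`). -/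
def block (S : OrderedSetPartition J) (a : Fin S.len) : Finset α := S.blocks.get a

/-- The union of the first `j` blocks. -/
def initialUnion (S : OrderedSetPartition J) (j : ℕ) : Finset α :=
  (S.blocks.take j).foldr (· ∪ ·) ∅

theorem nodup (S : OrderedSetPartition J) : S.blocks.Nodup := by
  refine List.Pairwise.imp_of_mem ?_ S.pairwise_disjoint
  intro A B hA _ hAB h
  subst h
  exact (S.nonempty_of_mem A hA).ne_empty (disjoint_self.mp hAB)

instance [Fintype α] : Finite (OrderedSetPartition J) :=
  Finite.of_injective
    (fun S : OrderedSetPartition J => (⟨S.blocks, S.nodup⟩ : {L : List (Finset α) // L.Nodup}))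
    (fun _ _ h => OrderedSetPartition.ext (congrArg Subtype.val h))

noncomputable instance [Fintype α] : Fintype (OrderedSetPartition J) := Fintype.ofFinite _

end General

/-- The plate of an ordered set partition `(S₁, …, Sₖ)` of `J ⊆ {1, …, n}`: the vectors of
`ℝⁿ` supported on `J`, with coordinate sum zero, such that the coordinates in
`S₁ ∪ ⋯ ∪ Sⱼ` have nonnegative sum for `j = 1, …, k - 1`. -/
def plate {n : ℕ} {J : Finset (Fin n)} (S : OrderedSetPartition J) : Set (Fin n → ℝ) :=
  {x | (∀ i, i ∉ J → x i = 0) ∧ ∑ i, x i = 0 ∧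
    ∀ j, 1 ≤ j → j < S.len → 0 ≤ ∑ i ∈ S.initialUnion j, x i}

/-- `T` is a shuffle-lumping of the ordered set partitions `S 0, …, S (l - 1)` (of subsets
`J 0, …, J (l - 1)` that together partition `{1, …, n}`): every block of `T` is a union of
blocks of the `S i`, and, for each `i`, the blocks of `S i` lie in blocks of `T` whose positions
strictly increase from left to right. -/
def IsShuffleLumping {n l : ℕ} {J : Fin l → Finset (Fin n)}
    (S : ∀ i, OrderedSetPartition (J i))
    (T : OrderedSetPartition (Finset.univ : Finset (Fin n))) : Prop :=
  (∀ p : Fin T.len, ∃ U : Finset (Finset (Fin n)),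
      (∀ B ∈ U, ∃ (i : Fin l) (a : Fin (S i).len), B = (S i).block a) ∧
      T.block p = U.biUnion id) ∧
  ∀ (i : Fin l) (a b : Fin (S i).len), a < b →
    ∀ p q : Fin T.len, (S i).block a ⊆ T.block p → (S i).block b ⊆ T.block q → p < q

open Classical in
/-- The finite set of all shuffle-lumpings of the given ordered set partitions. -/
noncomputable def shuffleLumpings {n l : ℕ} {J : Fin l → Finset (Fin n)}
    (S : ∀ i, OrderedSetPartition (J i)) :
    Finset (OrderedSetPartition (Finset.univ : Finset (Fin n))) :=
  Finset.univ.filter (fun T => IsShuffleLumping S T)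

end OrderedSetPartition

/-- The (complex-valued) characteristic function of a subset of `ℝⁿ`. -/
noncomputable def charFn {n : ℕ} (C : Set (Fin n → ℝ)) : (Fin n → ℝ) → ℂ :=
  C.indicator (fun _ => 1)

open scoped Pointwise in
/-- The convolution `[C₁] • ⋯ • [Cₗ]` of the characteristic functions of cones, which by
definition is the characteristic function of the Minkowski sum `C₁ + ⋯ + Cₗ`. -/
noncomputable def convolution {n l : ℕ} (C : Fin l → Set (Fin n → ℝ)) : (Fin n → ℝ) → ℂ :=
  charFn (∑ i, C i)

/-! Both sides vanish off the hyperplane of coordinate sum zero; fix `x` on it. Let `P` be the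
disjoint union of the chains of blocks, and give each block the weight `y p`, the sum of `x` over
it. The supports `J i` are disjoint, so `x` lies in the Minkowski sum exactly when every upper set
of `P` has weight at most zero (`mem_sum_plate_iff_upperNonpos`). Shuffle-lumpings correspond to
layerings of `P`, and membership in a plate says that the tails of the layering have weight at most
zero (`IsShuffleLumping.tailsNonpos_iff`).

What remains holds for any finite poset of total weight at most zero: `sum_layerings_tailsNonpos`.
Splitting off the first layer and inducting reduces it to the vanishing of the alternating sum, over
all sets `A` of minimal elements, of the indicator of `UpperNonpos y (U \ A)`. If `U` satisfies the
condition, so does every `U \ A`, and the binomial sum vanishes. Otherwise a minimal element outside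
a heaviest upper set can be toggled in `A` without changing the condition, so terms cancel in pairs.
-/

section ListUnion

variable {P : Type*} [DecidableEq P]

/-- The union of the members of a list of finite sets. -/
abbrev listUnion (L : List (Finset P)) : Finset P :=
  L.foldr (· ∪ ·) ∅

theorem mem_listUnion {L : List (Finset P)} {a : P} :
    a ∈ listUnion L ↔ ∃ A ∈ L, a ∈ A := by
  induction L with
  | nil => simp [listUnion]
  | cons B L ih =>
    simp only [listUnion, List.foldr_cons, Finset.mem_union, List.mem_cons,
      exists_eq_or_imp] at ih ⊢
    rw [ih]

/-- All proper final segments of `L` have nonpositive `y`-sum. -/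
def TailsNonpos (y : P → ℝ) (L : List (Finset P)) : Prop :=
  ∀ j, 1 ≤ j → j ≤ L.length → ∑ a ∈ listUnion (L.drop j), y a ≤ 0

theorem tailsNonpos_nil (y : P → ℝ) : TailsNonpos y [] := by
  intro j h1 h2
  simp at h2
  omega

theorem tailsNonpos_cons {y : P → ℝ} {A : Finset P} {L : List (Finset P)} :
    TailsNonpos y (A :: L) ↔ ∑ a ∈ listUnion L, y a ≤ 0 ∧ TailsNonpos y L := by
  constructor
  · intro h
    refine ⟨by simpa using h 1 le_rfl (by simp), fun j _ hj => ?_⟩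
    simpa using h (j + 1) (by omega) (by simpa using hj)
  · rintro ⟨h0, h⟩ j h1 hj
    obtain ⟨j, rfl⟩ := Nat.exists_eq_add_of_le' h1
    rcases Nat.eq_zero_or_pos j with rfl | hpos
    · simpa using h0
    · simpa using h j hpos (by simpa using hj)

end ListUnion

/-! ### Layerings of a finite poset and their alternating sum. -/

section Layerings

variable {P : Type*} [PartialOrder P]

open Classical in
/-- The minimal elements of a finite subset of a partial order. -/
noncomputable def minimalElements (U : Finset P) : Finset P :=
  U.filter fun a => ∀ b ∈ U, ¬ b < a

theorem mem_minimalElements {U : Finset P} {a : P} :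
    a ∈ minimalElements U ↔ a ∈ U ∧ ∀ b ∈ U, ¬ b < a := by
  classical
  simp [minimalElements]

theorem minimalElements_subset (U : Finset P) : minimalElements U ⊆ U :=
  fun _ h => (mem_minimalElements.mp h).1

theorem exists_mem_minimalElements_le {U : Finset P} {b : P} (hb : b ∈ U) :
    ∃ a ∈ minimalElements U, a ≤ b := by
  obtain ⟨a, hab, ha⟩ := U.exists_le_minimal hb
  exact ⟨a, mem_minimalElements.mpr ⟨ha.prop, fun c hc hca => ha.not_lt hc hca⟩, hab⟩

theorem minimalElements_nonempty {U : Finset P} (hU : U.Nonempty) :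
    (minimalElements U).Nonempty := by
  obtain ⟨b, hb⟩ := hU
  obtain ⟨a, ha, -⟩ := exists_mem_minimalElements_le hb
  exact ⟨a, ha⟩

variable [DecidableEq P]

theorem card_sdiff_lt_of_subset_minimalElements {U A : Finset P}
    (hA : A ∈ (minimalElements U).powerset.erase ∅) : (U \ A).card < U.card := by
  obtain ⟨hne, hsub⟩ := Finset.mem_erase.mp hA
  have hAU := (Finset.mem_powerset.mp hsub).trans (minimalElements_subset U)
  exact Finset.card_lt_card (Finset.sdiff_ssubset hAU (Finset.nonempty_iff_ne_empty.mpr hne))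

/-- The sequences of nonempty layers obtained from `U` by repeatedly removing a nonempty set of
minimal elements until nothing is left. -/
noncomputable def layerings (U : Finset P) : Finset (List (Finset P)) :=
  if U = ∅ then {[]} else
    ((minimalElements U).powerset.erase ∅).attach.biUnion fun A =>
      (layerings (U \ A.1)).image (List.cons A.1)
termination_by U.card
decreasing_by exact card_sdiff_lt_of_subset_minimalElements A.2

theorem layerings_empty : layerings (∅ : Finset P) = {[]} := by
  rw [layerings, if_pos rfl]

theorem nil_mem_layerings {U : Finset P} : [] ∈ layerings U ↔ U = ∅ := by
  by_cases hU : U = ∅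
  · simp [hU, layerings_empty]
  · rw [layerings, if_neg hU]
    simp [hU]

theorem cons_mem_layerings {U A : Finset P} {L : List (Finset P)} :
    A :: L ∈ layerings U ↔
      A.Nonempty ∧ A ⊆ minimalElements U ∧ L ∈ layerings (U \ A) := by
  by_cases hU : U = ∅
  · subst hU
    simp only [layerings_empty, Finset.mem_singleton, reduceCtorEq, false_iff]
    rintro ⟨⟨a, ha⟩, h, -⟩
    simpa using minimalElements_subset _ (h ha)
  · rw [layerings, if_neg hU]
    simp only [Finset.mem_biUnion, Finset.mem_attach, true_and, Finset.mem_image,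
      List.cons.injEq, Subtype.exists, Finset.mem_erase, Finset.mem_powerset]
    constructor
    · rintro ⟨B, hB, L', hL', rfl, rfl⟩
      exact ⟨Finset.nonempty_iff_ne_empty.mpr hB.1, hB.2, hL'⟩
    · rintro ⟨h1, h2, h3⟩
      exact ⟨A, ⟨h1.ne_empty, h2⟩, L, h3, rfl, rfl⟩

theorem sum_layerings {M : Type*} [AddCommMonoid M] {U : Finset P} (hU : U.Nonempty)
    (f : List (Finset P) → M) :
    ∑ L ∈ layerings U, f L =
      ∑ A ∈ (minimalElements U).powerset.erase ∅, ∑ L ∈ layerings (U \ A), f (A :: L) := by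
  rw [layerings, if_neg hU.ne_empty, Finset.sum_biUnion]
  · rw [← Finset.sum_attach ((minimalElements U).powerset.erase ∅)]
    refine Finset.sum_congr rfl fun A _ => ?_
    rw [Finset.sum_image]
    simp
  · intro A _ B _ hAB
    refine Finset.disjoint_left.mpr fun L hA hB => hAB (Subtype.ext ?_)
    obtain ⟨_, _, rfl⟩ := Finset.mem_image.mp hA
    obtain ⟨_, _, h⟩ := Finset.mem_image.mp hB
    exact ((List.cons.injEq _ _ _ _).mp h).1.symm

/-- The recursive definition serves the induction; this closed form, ordered partitions into
antichains compatible with the order, is what can be compared with shuffle-lumpings. -/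
theorem mem_layerings {U : Finset P} {L : List (Finset P)} :
    L ∈ layerings U ↔ (∀ A ∈ L, A.Nonempty) ∧ L.Pairwise Disjoint ∧ listUnion L = U ∧
      (∀ A ∈ L, ∀ a ∈ A, ∀ b ∈ A, ¬ a < b) ∧
      L.Pairwise (fun A B => ∀ a ∈ A, ∀ b ∈ B, ¬ b < a) := by
  induction L generalizing U with
  | nil => simp [nil_mem_layerings, eq_comm]
  | cons A L ih =>
    rw [cons_mem_layerings, ih]
    simp only [List.forall_mem_cons, List.pairwise_cons]
    constructor
    · rintro ⟨hne, hA, h1, h2, h3, h4, h5⟩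
      have hAU := hA.trans (minimalElements_subset U)
      have key : ∀ B ∈ L, ∀ b ∈ B, b ∈ U \ A := fun B hB b hb =>
        h3 ▸ mem_listUnion.mpr ⟨B, hB, hb⟩
      refine ⟨⟨hne, h1⟩, ⟨fun B hB => ?_, h2⟩, ?_, ⟨fun a ha b hb => ?_, h4⟩,
        fun B hB a ha b hb => ?_, h5⟩
      · exact Finset.disjoint_right.mpr fun b hb => (Finset.mem_sdiff.mp (key B hB b hb)).2
      · change A ∪ listUnion L = U
        rw [h3, Finset.union_sdiff_of_subset hAU]
      · exact (mem_minimalElements.mp (hA hb)).2 a (hAU ha)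
      · exact (mem_minimalElements.mp (hA ha)).2 b (Finset.mem_sdiff.mp (key B hB b hb)).1
    · rintro ⟨⟨hne, h1⟩, ⟨hd, h2⟩, h3, ⟨ha, h4⟩, hp, h5⟩
      change A ∪ listUnion L = U at h3
      subst h3
      refine ⟨hne, fun a haA => mem_minimalElements.mpr
        ⟨Finset.mem_union_left _ haA, fun b hb => ?_⟩, h1, h2, ?_, h4, h5⟩
      · rcases Finset.mem_union.mp hb with hb | hb
        · exact ha b hb a haA
        · obtain ⟨B, hB, hb⟩ := mem_listUnion.mp hb
          exact hp B hB a haA b hb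
      · refine (Finset.union_sdiff_cancel_left ?_).symm
        refine Finset.disjoint_right.mpr fun b hb => ?_
        obtain ⟨B, hB, hb⟩ := mem_listUnion.mp hb
        exact Finset.disjoint_right.mp (hd B hB) hb

/-- Every upper subset of `U` has nonpositive `y`-sum. -/
def UpperNonpos (y : P → ℝ) (U : Finset P) : Prop :=
  ∀ V ⊆ U, (∀ a ∈ V, ∀ b ∈ U, a < b → b ∈ V) → ∑ a ∈ V, y a ≤ 0

/-- A minimal element lies above nothing, so an upper subset of `U \ A` is still upper in `U`. -/
theorem UpperNonpos.sdiff {y : P → ℝ} {U A : Finset P} (h : UpperNonpos y U)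
    (hA : A ⊆ minimalElements U) : UpperNonpos y (U \ A) := by
  intro V hV hup
  refine h V (hV.trans Finset.sdiff_subset) fun a ha b hb hab => hup a ha b ?_ hab
  refine Finset.mem_sdiff.mpr ⟨hb, fun hbA => ?_⟩
  exact (mem_minimalElements.mp (hA hbA)).2 a (Finset.mem_sdiff.mp (hV ha)).1 hab

/-- If some upper subset of `U` has positive sum, there is a minimal element of `U` whose removal
never changes whether the remaining upper subsets are all nonpositive. -/
theorem exists_minimalElement_toggle {y : P → ℝ} {U : Finset P} (hy : ∑ a ∈ U, y a ≤ 0)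
    (h : ¬ UpperNonpos y U) :
    ∃ x ∈ minimalElements U, ∀ A ⊆ (minimalElements U).erase x,
      (UpperNonpos y (U \ insert x A) ↔ UpperNonpos y (U \ A)) := by
  classical
  -- `V` is an upper set of greatest weight. Its weight is positive while that of `U` is not, so `V`
  -- misses some element, hence also a minimal element `x` below it.
  obtain ⟨V, hV, hmax⟩ := Finset.exists_max_image
    (U.powerset.filter fun V => ∀ a ∈ V, ∀ b ∈ U, a < b → b ∈ V) (fun V => ∑ a ∈ V, y a)
    ⟨∅, by simp⟩
  simp only [Finset.mem_filter, Finset.mem_powerset, and_imp] at hV hmax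
  obtain ⟨hVU, hVup⟩ := hV
  have hpos : 0 < ∑ a ∈ V, y a := by
    unfold UpperNonpos at h
    push Not at h
    obtain ⟨W, hW, hWup, hWpos⟩ := h
    exact hWpos.trans_le (hmax W hW hWup)
  have hne : ∃ b ∈ U, b ∉ V := by
    by_contra! hcon
    rw [Finset.Subset.antisymm hVU hcon] at hpos
    exact absurd hpos (not_lt.mpr hy)
  obtain ⟨b, hbU, hbV⟩ := hne
  obtain ⟨x, hx, hxb⟩ := exists_mem_minimalElements_le hbU
  have hxV : x ∉ V := fun hxV => hbV <| by
    rcases hxb.eq_or_lt with rfl | hlt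
    · exact hxV
    · exact hVup x hxV b hbU hlt
  refine ⟨x, hx, fun A hA => ?_⟩
  have hA' : A ⊆ minimalElements U := hA.trans (Finset.erase_subset _ _)
  constructor
  · intro hE W hW hWup
    have hWU : W ⊆ U := hW.trans Finset.sdiff_subset
    have hWup' : ∀ a ∈ W, ∀ b ∈ U, a < b → b ∈ W := fun a ha b hb hab =>
      hWup a ha b (Finset.mem_sdiff.mpr ⟨hb, fun hbA =>
        (mem_minimalElements.mp (hA' hbA)).2 a (hWU ha) hab⟩) hab
    -- Uncrossing: `W ∩ V` avoids `x`, so `hE` applies to it, and `W ∪ V` weighs at most as much as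
    -- `V`. Modularity of the weight then gives the bound for `W`.
    have h1 : ∑ a ∈ W ∩ V, y a ≤ 0 := by
      refine hE _ (fun a ha => ?_) (fun a ha b hb hab => ?_)
      · obtain ⟨haW, haV⟩ := Finset.mem_inter.mp ha
        have := Finset.mem_sdiff.mp (hW haW)
        refine Finset.mem_sdiff.mpr ⟨this.1, fun hi => ?_⟩
        rcases Finset.mem_insert.mp hi with rfl | hi
        · exact hxV haV
        · exact this.2 hi
      · obtain ⟨haW, haV⟩ := Finset.mem_inter.mp ha
        have hbU := (Finset.mem_sdiff.mp hb).1
        exact Finset.mem_inter.mpr ⟨hWup' a haW b hbU hab, hVup a haV b hbU hab⟩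
    have h2 : ∑ a ∈ W ∪ V, y a ≤ ∑ a ∈ V, y a := by
      refine hmax _ (Finset.union_subset hWU hVU) fun a ha b hb hab => ?_
      rcases Finset.mem_union.mp ha with ha | ha
      · exact Finset.mem_union_left _ (hWup' a ha b hb hab)
      · exact Finset.mem_union_right _ (hVup a ha b hb hab)
    have h3 := Finset.sum_union_inter (s₁ := W) (s₂ := V) (f := y)
    linarith
  · intro hE
    have : U \ insert x A = (U \ A) \ {x} := by
      ext a
      simp only [Finset.mem_sdiff, Finset.mem_insert, Finset.mem_singleton]
      tauto
    rw [this]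
    refine hE.sdiff (Finset.singleton_subset_iff.mpr (mem_minimalElements.mpr ⟨?_, ?_⟩))
    · exact Finset.mem_sdiff.mpr ⟨minimalElements_subset U hx, fun hxA =>
        (Finset.mem_erase.mp (hA hxA)).1 rfl⟩
    · exact fun c hc => (mem_minimalElements.mp hx).2 c (Finset.mem_sdiff.mp hc).1

-- The terms cancel either as a binomial sum or in the pairs `A`, `insert x A` with `x` from
-- `exists_minimalElement_toggle`.
open Classical in
theorem sum_powerset_minimalElements_upperNonpos {y : P → ℝ} {U : Finset P} (hU : U.Nonempty)
    (hy : ∑ a ∈ U, y a ≤ 0) :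
    ∑ A ∈ (minimalElements U).powerset,
      (-1 : ℂ) ^ A.card * (if UpperNonpos y (U \ A) then 1 else 0) = 0 := by
  by_cases h : UpperNonpos y U
  · rw [Finset.sum_congr rfl fun A hA => by
      rw [if_pos (h.sdiff (Finset.mem_powerset.mp hA)), mul_one]]
    have := Finset.sum_powerset_neg_one_pow_card_of_nonempty (minimalElements_nonempty hU)
    exact_mod_cast congrArg (Int.cast : ℤ → ℂ) this
  · obtain ⟨x, hx, htog⟩ := exists_minimalElement_toggle hy h
    have hnot : x ∉ (minimalElements U).erase x := Finset.notMem_erase _ _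
    rw [← Finset.insert_erase hx, Finset.sum_powerset_insert hnot, ← Finset.sum_add_distrib]
    refine Finset.sum_eq_zero fun A hA => ?_
    have hA := Finset.mem_powerset.mp hA
    rw [Finset.card_insert_of_notMem fun hxA => hnot (hA hxA), pow_succ]
    simp only [htog A hA]
    ring

open Classical in
/-- The alternating sum over the layerings of `U` all of whose proper final segments are
nonpositive detects whether all upper subsets of `U` are nonpositive. -/
theorem sum_layerings_tailsNonpos (y : P → ℝ) (U : Finset P) (hy : ∑ a ∈ U, y a ≤ 0) :
    ∑ L ∈ layerings U, (-1 : ℂ) ^ (U.card + L.length) * (if TailsNonpos y L then 1 else 0) =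
      if UpperNonpos y U then 1 else 0 := by
  induction hc : U.card using Nat.strong_induction_on generalizing U with
  | _ c ih =>
    subst hc
    rcases U.eq_empty_or_nonempty with rfl | hU
    · have : UpperNonpos y (∅ : Finset P) := by
        intro V hV _
        simp [Finset.subset_empty.mp hV]
      simp [layerings_empty, tailsNonpos_nil, this]
    · rw [sum_layerings hU]
      have step : ∀ A ∈ (minimalElements U).powerset.erase ∅,
          ∑ L ∈ layerings (U \ A), (-1 : ℂ) ^ (U.card + (A :: L).length) *
            (if TailsNonpos y (A :: L) then 1 else 0) =
          -((-1 : ℂ) ^ A.card * (if UpperNonpos y (U \ A) then 1 else 0)) := by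
        intro A hA
        have hlt := card_sdiff_lt_of_subset_minimalElements hA
        have hAU : A ⊆ U := (Finset.mem_powerset.mp (Finset.mem_erase.mp hA).2).trans
          (minimalElements_subset U)
        have hcard : U.card = A.card + (U \ A).card := by
          rw [Finset.card_sdiff_of_subset hAU]
          have := Finset.card_le_card hAU
          omega
        by_cases hs : ∑ a ∈ U \ A, y a ≤ 0
        · rw [← ih _ hlt _ hs rfl, Finset.mul_sum, ← Finset.sum_neg_distrib]
          refine Finset.sum_congr rfl fun L hL => ?_
          have hLU : listUnion L = U \ A := (mem_layerings.mp hL).2.2.1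
          simp only [tailsNonpos_cons, hLU, hs, true_and, List.length_cons]
          rw [hcard]
          ring
        -- When `U \ A` has positive weight the induction hypothesis is unavailable, but both sides
        -- are zero: `U \ A` is an upper subset of itself and also the first proper tail of `A ::
        -- L`.
        · rw [if_neg fun h => hs (h _ subset_rfl fun _ _ _ hb _ => hb), mul_zero, neg_zero]
          refine Finset.sum_eq_zero fun L hL => ?_
          have hLU : listUnion L = U \ A := (mem_layerings.mp hL).2.2.1
          rw [if_neg, mul_zero]
          rw [tailsNonpos_cons, hLU]
          exact fun h => hs h.1
      rw [Finset.sum_congr rfl step, Finset.sum_neg_distrib]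
      -- The term `A = ∅` of this vanishing sum is the indicator sought; the other terms are those
      -- of `step` up to sign.
      have h0 := sum_powerset_minimalElements_upperNonpos hU hy
      rw [← Finset.add_sum_erase _ _ (Finset.empty_mem_powerset _)] at h0
      simp only [Finset.card_empty, pow_zero, one_mul, Finset.sdiff_empty] at h0
      linear_combination -h0

end Layerings

/-! ### Unions of members of a disjoint family. -/

section Parts

variable {P β : Type*} [DecidableEq β]

theorem mem_of_subset_biUnion {blk : P → Finset β} (hne : ∀ p, (blk p).Nonempty)
    (hd : ∀ p q, p ≠ q → Disjoint (blk p) (blk q)) {A : Finset P} {p : P}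
    (h : blk p ⊆ A.biUnion blk) : p ∈ A := by
  obtain ⟨x, hx⟩ := hne p
  obtain ⟨q, hq, hxq⟩ := Finset.mem_biUnion.mp (h hx)
  by_cases hpq : p = q
  · exact hpq ▸ hq
  · exact absurd hxq (Finset.disjoint_left.mp (hd p q hpq) hx)

theorem listUnion_map_biUnion [DecidableEq P] (blk : P → Finset β) (L : List (Finset P)) :
    listUnion (L.map fun A => A.biUnion blk) = (listUnion L).biUnion blk := by
  ext x
  simp only [mem_listUnion, List.mem_map, Finset.mem_biUnion]
  constructor
  · rintro ⟨_, ⟨A, hA, rfl⟩, hx⟩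
    obtain ⟨p, hp, hx⟩ := Finset.mem_biUnion.mp hx
    exact ⟨p, ⟨A, hA, hp⟩, hx⟩
  · rintro ⟨p, ⟨A, hA, hp⟩, hx⟩
    exact ⟨_, ⟨A, hA, rfl⟩, Finset.mem_biUnion.mpr ⟨p, hp, hx⟩⟩

variable [Fintype P]

/-- The indices of the members of the family `blk` contained in `B`. -/
def partsOf (blk : P → Finset β) (B : Finset β) : Finset P :=
  Finset.univ.filter fun p => blk p ⊆ B

theorem mem_partsOf {blk : P → Finset β} {B : Finset β} {p : P} :
    p ∈ partsOf blk B ↔ blk p ⊆ B := by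
  simp [partsOf]

theorem partsOf_biUnion {blk : P → Finset β} (hne : ∀ p, (blk p).Nonempty)
    (hd : ∀ p q, p ≠ q → Disjoint (blk p) (blk q)) (A : Finset P) :
    partsOf blk (A.biUnion blk) = A := by
  ext p
  rw [mem_partsOf]
  exact ⟨mem_of_subset_biUnion hne hd, fun h => Finset.subset_biUnion_of_mem blk h⟩

end Parts

namespace OrderedSetPartition

/-! ### Sums over initial and final segments of blocks. -/

section Sums

variable {α : Type*} [DecidableEq α] {J : Finset α}

theorem mem_initialUnion (S : OrderedSetPartition J) {j : ℕ} {x : α} :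
    x ∈ S.initialUnion j ↔ ∃ a : Fin S.len, (a : ℕ) < j ∧ x ∈ S.block a := by
  change x ∈ listUnion (S.blocks.take j) ↔ _
  simp only [mem_listUnion, List.mem_take_iff_getElem]
  constructor
  · rintro ⟨_, ⟨a, ha, rfl⟩, hx⟩
    exact ⟨⟨a, (lt_min_iff.mp ha).2⟩, (lt_min_iff.mp ha).1, hx⟩
  · rintro ⟨a, ha, hx⟩
    exact ⟨_, ⟨a, lt_min ha a.2, rfl⟩, hx⟩

theorem initialUnion_len (S : OrderedSetPartition J) : S.initialUnion S.len = J := by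
  rw [initialUnion, len, List.take_length, S.union_eq]

theorem block_nonempty (S : OrderedSetPartition J) (a : Fin S.len) : (S.block a).Nonempty :=
  S.nonempty_of_mem _ (List.get_mem _ _)

theorem block_disjoint (S : OrderedSetPartition J) {a b : Fin S.len} (h : a ≠ b) :
    Disjoint (S.block a) (S.block b) := by
  have := List.pairwise_iff_get.mp S.pairwise_disjoint
  rcases lt_or_gt_of_ne h with h | h
  · exact this a b h
  · exact (this b a h).symm

theorem mem_iff_exists_block (S : OrderedSetPartition J) {x : α} :
    x ∈ J ↔ ∃ a, x ∈ S.block a := by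
  conv_lhs => rw [← S.initialUnion_len]
  rw [mem_initialUnion]
  exact ⟨fun ⟨a, _, h⟩ => ⟨a, h⟩, fun ⟨a, h⟩ => ⟨a, a.2, h⟩⟩

theorem block_subset (S : OrderedSetPartition J) (a : Fin S.len) : S.block a ⊆ J :=
  fun _ hx => S.mem_iff_exists_block.mpr ⟨a, hx⟩

theorem initialUnion_subset (S : OrderedSetPartition J) (j : ℕ) : S.initialUnion j ⊆ J :=
  fun _ hx => let ⟨a, _, h⟩ := S.mem_initialUnion.mp hx; S.block_subset a h

theorem sum_initialUnion {M : Type*} [AddCommMonoid M] (S : OrderedSetPartition J) (x : α → M)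
    (j : ℕ) :
    ∑ i ∈ S.initialUnion j, x i =
      ∑ a ∈ Finset.univ.filter (fun a : Fin S.len => (a : ℕ) < j), ∑ i ∈ S.block a, x i := by
  rw [← Finset.sum_biUnion fun a _ b _ h => S.block_disjoint h]
  refine Finset.sum_congr ?_ fun _ _ => rfl
  ext i
  simp [mem_initialUnion]

theorem sum_initialUnion_add_sum_tail {M : Type*} [AddCommMonoid M] (S : OrderedSetPartition J)
    (x : α → M) (j : ℕ) :
    ∑ i ∈ S.initialUnion j, x i +
      ∑ a ∈ Finset.univ.filter (fun a : Fin S.len => j ≤ (a : ℕ)), ∑ i ∈ S.block a, x i =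
      ∑ i ∈ J, x i := by
  have h := S.sum_initialUnion x S.len
  rw [initialUnion_len] at h
  rw [h, sum_initialUnion]
  have h1 : Finset.univ.filter (fun a : Fin S.len => (a : ℕ) < S.len) = Finset.univ := by
    simp
  rw [h1, ← Finset.sum_filter_add_sum_filter_not Finset.univ (fun a : Fin S.len => (a : ℕ) < j)]
  simp only [not_lt]

theorem sum_initialUnion_add_sum_drop {M : Type*} [AddCommMonoid M] (S : OrderedSetPartition J)
    (x : α → M) (j : ℕ) :
    ∑ i ∈ S.initialUnion j, x i + ∑ i ∈ listUnion (S.blocks.drop j), x i = ∑ i ∈ J, x i := by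
  change ∑ i ∈ listUnion (S.blocks.take j), x i + _ = _
  rw [← Finset.sum_union]
  · refine Finset.sum_congr ?_ fun _ _ => rfl
    have h : listUnion S.blocks = J := S.union_eq
    conv_rhs => rw [← h, ← List.take_append_drop j S.blocks]
    ext i
    simp only [Finset.mem_union, mem_listUnion, List.mem_append, or_and_right, exists_or]
  · have h := S.pairwise_disjoint
    rw [← List.take_append_drop j S.blocks, List.pairwise_append] at h
    refine Finset.disjoint_left.mpr fun i hi hi' => ?_
    obtain ⟨A, hA, hiA⟩ := mem_listUnion.mp hi
    obtain ⟨B, hB, hiB⟩ := mem_listUnion.mp hi'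
    exact Finset.disjoint_left.mp (h.2.2 A hA B hB) hiA hiB

end Sums

/-! ### From plates and shuffle-lumpings to the poset of blocks. -/

section Family

variable {n l : ℕ} {J : Fin l → Finset (Fin n)} (S : ∀ i, OrderedSetPartition (J i))

/-- The disjoint union of the chains of blocks of the members of a family of ordered set
partitions, with its partial order. -/
abbrev BlockIndex : Type := Σ i, Fin (S i).len

/-- The block with a given index. -/
def blockAt (p : BlockIndex S) : Finset (Fin n) := (S p.1).block p.2

theorem blockAt_nonempty (p : BlockIndex S) : (blockAt S p).Nonempty :=
  (S p.1).block_nonempty p.2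

theorem blockAt_disjoint (hdisj : ∀ i j, i ≠ j → Disjoint (J i) (J j)) (p q : BlockIndex S)
    (h : p ≠ q) : Disjoint (blockAt S p) (blockAt S q) := by
  obtain ⟨i, a⟩ := p
  obtain ⟨j, b⟩ := q
  by_cases hij : i = j
  · subst hij
    exact (S i).block_disjoint fun hab => h (congrArg (Sigma.mk i) hab)
  · exact (hdisj i j hij).mono ((S i).block_subset a) ((S j).block_subset b)

theorem exists_mem_blockAt (hunion : Finset.univ.biUnion J = Finset.univ) (x : Fin n) :
    ∃ p, x ∈ blockAt S p := by
  have hx : x ∈ Finset.univ.biUnion J := hunion ▸ Finset.mem_univ x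
  obtain ⟨i, -, hi⟩ := Finset.mem_biUnion.mp hx
  obtain ⟨a, ha⟩ := (S i).mem_iff_exists_block.mp hi
  exact ⟨⟨i, a⟩, ha⟩

theorem sum_biUnion_blockAt (hdisj : ∀ i j, i ≠ j → Disjoint (J i) (J j)) (x : Fin n → ℝ)
    (A : Finset (BlockIndex S)) :
    ∑ i ∈ A.biUnion (blockAt S), x i = ∑ p ∈ A, ∑ i ∈ blockAt S p, x i :=
  Finset.sum_biUnion fun p _ q _ h => blockAt_disjoint S hdisj p q h

-- Disjoint supports force the decomposition: the `i`-th summand can only be the restriction of `x`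
-- to `J i`.
open scoped Pointwise in
theorem mem_sum_plate (hdisj : ∀ i j, i ≠ j → Disjoint (J i) (J j))
    (hunion : Finset.univ.biUnion J = Finset.univ) (x : Fin n → ℝ) :
    x ∈ ∑ i, (S i).plate ↔ ∀ i, ∑ k ∈ J i, x k = 0 ∧
      ∀ j, 1 ≤ j → j < (S i).len → 0 ≤ ∑ k ∈ (S i).initialUnion j, x k := by
  rw [Set.mem_fintype_sum]
  constructor
  · rintro ⟨g, hg, rfl⟩ i
    have hres : ∀ A ⊆ J i, ∑ k ∈ A, (∑ j, g j) k = ∑ k ∈ A, g i k := fun A hA => by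
      refine Finset.sum_congr rfl fun k hk => ?_
      rw [Finset.sum_apply]
      refine Finset.sum_eq_single i (fun j _ hj => (hg j).1 k fun hkj => ?_) (by simp)
      exact Finset.disjoint_left.mp (hdisj j i hj) hkj (hA hk)
    refine ⟨?_, fun j h1 h2 => ?_⟩
    · rw [hres _ subset_rfl, ← (hg i).2.1]
      exact Finset.sum_subset (Finset.subset_univ _) fun k _ hk => (hg i).1 k hk
    · rw [hres _ ((S i).initialUnion_subset j)]
      exact (hg i).2.2 j h1 h2
  · intro h
    have hres : ∀ i, ∀ A ⊆ J i, ∑ k ∈ A, (if k ∈ J i then x k else 0) = ∑ k ∈ A, x k :=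
      fun i A hA => Finset.sum_congr rfl fun k hk => if_pos (hA hk)
    refine ⟨fun i k => if k ∈ J i then x k else 0, fun i => ⟨fun k hk => if_neg hk, ?_, ?_⟩, ?_⟩
    · simpa using (h i).1
    · intro j h1 h2
      rw [hres i _ ((S i).initialUnion_subset j)]
      exact (h i).2 j h1 h2
    · ext k
      have hk : k ∈ Finset.univ.biUnion J := hunion ▸ Finset.mem_univ k
      obtain ⟨i, -, hi⟩ := Finset.mem_biUnion.mp hk
      rw [Finset.sum_apply, Finset.sum_eq_single i, if_pos hi]
      · intro j _ hj
        exact if_neg fun hkj => Finset.disjoint_left.mp (hdisj j i hj) hkj hi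
      · simp

theorem sum_filter_blockIndex {M : Type*} [AddCommMonoid M] (y : BlockIndex S → M)
    (V : Finset (BlockIndex S)) :
    ∑ p ∈ V, y p = ∑ i, ∑ a ∈ Finset.univ.filter (fun a => (⟨i, a⟩ : BlockIndex S) ∈ V),
      y ⟨i, a⟩ := by
  simp only [Finset.sum_filter]
  rw [← Fintype.sum_sigma' (fun i a => if (⟨i, a⟩ : BlockIndex S) ∈ V then y ⟨i, a⟩ else 0),
    ← Finset.sum_filter]
  simp

-- An upper set meets each chain in a final segment, whose weight is minus that of the complementary
-- initial segment once `x` sums to zero on `J i`.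
open scoped Pointwise in
theorem mem_sum_plate_iff_upperNonpos (hdisj : ∀ i j, i ≠ j → Disjoint (J i) (J j))
    (hunion : Finset.univ.biUnion J = Finset.univ) (x : Fin n → ℝ) (hx : ∑ i, x i = 0) :
    x ∈ ∑ i, (S i).plate ↔
      UpperNonpos (fun p => ∑ k ∈ blockAt S p, x k) (Finset.univ : Finset (BlockIndex S)) := by
  rw [mem_sum_plate S hdisj hunion]
  constructor
  · intro h V _ hV
    rw [sum_filter_blockIndex]
    refine Finset.sum_nonpos fun i _ => ?_
    rcases (Finset.univ.filter fun a => (⟨i, a⟩ : BlockIndex S) ∈ V).eq_empty_or_nonempty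
      with he | hne
    · rw [he, Finset.sum_empty]
    -- `c` is the lowest position of `V` in chain `i`; upward closure makes the trace of `V` the
    -- final segment from `c`.
    · obtain ⟨c, hc, hmin⟩ := Finset.exists_min_image _ id hne
      simp only [Finset.mem_filter, Finset.mem_univ, true_and, id] at hc hmin
      have heq : Finset.univ.filter (fun a => (⟨i, a⟩ : BlockIndex S) ∈ V) =
          Finset.univ.filter fun a : Fin (S i).len => (c : ℕ) ≤ (a : ℕ) := by
        refine Finset.filter_congr fun a _ => ⟨fun ha => hmin a ha, fun ha => ?_⟩
        rcases (show c ≤ a from ha).eq_or_lt with rfl | hlt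
        · exact hc
        · exact hV _ hc _ (Finset.mem_univ _) (Sigma.mk_lt_mk_iff.mpr hlt)
      have hs := (S i).sum_initialUnion_add_sum_tail x c
      rw [heq]
      change ∑ a ∈ _, ∑ k ∈ (S i).block a, x k ≤ 0
      rw [(h i).1] at hs
      have h0 : 0 ≤ ∑ k ∈ (S i).initialUnion c, x k := by
        rcases Nat.eq_zero_or_pos (c : ℕ) with h0 | h0
        · rw [h0]
          simp [initialUnion]
        · exact (h i).2 c h0 c.2
      linarith
  · intro h
    have key : ∀ i c, ∑ k ∈ J i, x k ≤ ∑ k ∈ (S i).initialUnion c, x k := by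
      intro i c
      have hV := h (Finset.univ.filter fun p => p.1 = i ∧ c ≤ (p.2 : ℕ)) (Finset.subset_univ _) ?_
      · rw [sum_filter_blockIndex, Finset.sum_eq_single i] at hV
        · have hs := (S i).sum_initialUnion_add_sum_tail x c
          simp only [Finset.mem_filter, Finset.mem_univ, true_and] at hV
          change ∑ a ∈ _, ∑ k ∈ (S i).block a, x k ≤ 0 at hV
          linarith
        · intro j _ hj
          simp [hj]
        · simp
      · rintro ⟨i, a⟩ ha ⟨j, b⟩ - hab
        obtain ⟨hij, hlt⟩ := Sigma.lt_def.mp hab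
        cases hij
        simp only [Finset.mem_filter, Finset.mem_univ, true_and] at ha ⊢
        exact ⟨ha.1, ha.2.trans (le_of_lt hlt)⟩
    -- Each whole chain is an upper set, so its weight is at most zero; as these weights add up to
    -- zero, each one is zero.
    have hle : ∀ i ∈ (Finset.univ : Finset (Fin l)), ∑ k ∈ J i, x k ≤ 0 := fun i _ => by
      simpa [initialUnion] using key i 0
    have htot : ∑ i, ∑ k ∈ J i, x k = 0 := by
      rw [← Finset.sum_biUnion fun i _ j _ hij => hdisj i j hij, hunion, hx]
    have hz := (Finset.sum_eq_zero_iff_of_nonpos hle).mp htot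
    exact fun i => ⟨hz i (Finset.mem_univ i), fun j _ _ => hz i (Finset.mem_univ i) ▸ key i j⟩

variable {S}

theorem IsShuffleLumping.biUnion_partsOf
    {T : OrderedSetPartition (Finset.univ : Finset (Fin n))} (hT : IsShuffleLumping S T)
    {B : Finset (Fin n)} (hB : B ∈ T.blocks) :
    (partsOf (blockAt S) B).biUnion (blockAt S) = B := by
  obtain ⟨p, rfl⟩ := List.mem_iff_get.mp hB
  obtain ⟨U, hU, hUp⟩ := hT.1 p
  refine Finset.Subset.antisymm
    (Finset.biUnion_subset.mpr fun q hq => mem_partsOf.mp hq) fun x hx => ?_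
  change x ∈ T.block p at hx
  rw [hUp] at hx
  obtain ⟨C, hC, hxC⟩ := Finset.mem_biUnion.mp hx
  obtain ⟨i, a, rfl⟩ := hU C hC
  refine Finset.mem_biUnion.mpr ⟨⟨i, a⟩, mem_partsOf.mpr ?_, hxC⟩
  change _ ⊆ T.block p
  rw [hUp]
  exact Finset.subset_biUnion_of_mem id hC

theorem IsShuffleLumping.listUnion_map_partsOf
    {T : OrderedSetPartition (Finset.univ : Finset (Fin n))} (hT : IsShuffleLumping S T)
    {L : List (Finset (Fin n))} (hL : ∀ B ∈ L, B ∈ T.blocks) :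
    (listUnion (L.map (partsOf (blockAt S)))).biUnion (blockAt S) = listUnion L := by
  rw [← listUnion_map_biUnion, List.map_map]
  congr 1
  exact (List.map_congr_left fun B hB => hT.biUnion_partsOf (hL B hB)).trans (List.map_id' L)

theorem IsShuffleLumping.lt_of_lt
    {T : OrderedSetPartition (Finset.univ : Finset (Fin n))} (hT : IsShuffleLumping S T)
    {p q : BlockIndex S} (hpq : p < q) {u v : Fin T.len}
    (hu : blockAt S p ⊆ T.block u) (hv : blockAt S q ⊆ T.block v) : u < v := by
  obtain ⟨i, a⟩ := p
  obtain ⟨j, b⟩ := q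
  obtain ⟨hij, hlt⟩ := Sigma.lt_def.mp hpq
  cases hij
  exact hT.2 i a b hlt u v hu hv

theorem IsShuffleLumping.map_partsOf_mem_layerings
    (hdisj : ∀ i j, i ≠ j → Disjoint (J i) (J j))
    {T : OrderedSetPartition (Finset.univ : Finset (Fin n))} (hT : IsShuffleLumping S T) :
    T.blocks.map (partsOf (blockAt S)) ∈ layerings (Finset.univ : Finset (BlockIndex S)) := by
  rw [mem_layerings]
  simp only [List.forall_mem_map, List.pairwise_map]
  refine ⟨fun B hB => ?_, T.pairwise_disjoint.imp fun {B C} hBC => ?_, ?_,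
    fun B hB a ha b hb hab => ?_, ?_⟩
  · have h := T.nonempty_of_mem B hB
    rw [← hT.biUnion_partsOf hB] at h
    exact (Finset.biUnion_nonempty.mp h).imp fun _ h => h.1
  · refine Finset.disjoint_left.mpr fun p hp hp' => ?_
    obtain ⟨x, hx⟩ := blockAt_nonempty S p
    exact Finset.disjoint_left.mp hBC (mem_partsOf.mp hp hx) (mem_partsOf.mp hp' hx)
  · refine Finset.eq_univ_of_forall fun p => mem_of_subset_biUnion (blockAt_nonempty S)
      (blockAt_disjoint S hdisj) ?_
    rw [hT.listUnion_map_partsOf fun _ h => h]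
    exact (Finset.subset_univ _).trans T.union_eq.ge
  · obtain ⟨u, rfl⟩ := List.mem_iff_get.mp hB
    exact lt_irrefl _ (hT.lt_of_lt hab (u := u) (v := u) (mem_partsOf.mp ha) (mem_partsOf.mp hb))
  · refine List.pairwise_iff_get.mpr fun u v huv a ha b hb hba => ?_
    exact lt_asymm huv
      (hT.lt_of_lt hba (u := v) (v := u) (mem_partsOf.mp hb) (mem_partsOf.mp ha))

/-- Replacing each layer by the union of its blocks inverts `partsOf`, since the blocks are nonempty
and disjoint. Blocks of one chain are comparable, so the antichain condition keeps them out of a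
common layer and the order condition keeps the layers increasing. -/
theorem exists_isShuffleLumping_of_mem_layerings
    (hdisj : ∀ i j, i ≠ j → Disjoint (J i) (J j))
    (hunion : Finset.univ.biUnion J = Finset.univ) {L : List (Finset (BlockIndex S))}
    (hL : L ∈ layerings (Finset.univ : Finset (BlockIndex S))) :
    ∃ T, IsShuffleLumping S T ∧ T.blocks.map (partsOf (blockAt S)) = L := by
  obtain ⟨hne, hd, hu, hanti, hlt⟩ := mem_layerings.mp hL
  have hparts := partsOf_biUnion (blockAt_nonempty S) (blockAt_disjoint S hdisj)
  refine ⟨⟨L.map fun A => A.biUnion (blockAt S), ?_, ?_, ?_⟩, ⟨fun p => ?_, ?_⟩, ?_⟩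
  · simp only [List.forall_mem_map]
    exact fun A hA => Finset.Nonempty.biUnion (hne A hA) fun p _ => blockAt_nonempty S p
  · refine List.pairwise_map.mpr (hd.imp fun {A B} hAB => ?_)
    simp only [Finset.disjoint_biUnion_left, Finset.disjoint_biUnion_right]
    exact fun p hp q hq => blockAt_disjoint S hdisj _ _ fun h =>
      Finset.disjoint_left.mp hAB hq (h ▸ hp)
  · refine (listUnion_map_biUnion (blockAt S) L).trans ?_
    rw [hu]
    refine Finset.eq_univ_of_forall fun x => ?_
    obtain ⟨p, hp⟩ := exists_mem_blockAt S hunion x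
    exact Finset.mem_biUnion.mpr ⟨p, Finset.mem_univ p, hp⟩
  · have hp : (p : ℕ) < L.length := by simpa [len] using p.2
    refine ⟨(L[p]).image (blockAt S), fun B hB => ?_, ?_⟩
    · obtain ⟨q, -, rfl⟩ := Finset.mem_image.mp hB
      exact ⟨q.1, q.2, rfl⟩
    · rw [Finset.image_biUnion]
      exact List.getElem_map _
  · intro i a b hab p q hpa hqb
    have hp : (p : ℕ) < L.length := by simpa [len] using p.2
    have hq : (q : ℕ) < L.length := by simpa [len] using q.2
    have hpa : blockAt S ⟨i, a⟩ ⊆ (L[p]).biUnion (blockAt S) :=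
      hpa.trans (List.getElem_map _).subset
    have hqb : blockAt S ⟨i, b⟩ ⊆ (L[q]).biUnion (blockAt S) :=
      hqb.trans (List.getElem_map _).subset
    have ha := mem_of_subset_biUnion (blockAt_nonempty S) (blockAt_disjoint S hdisj) hpa
    have hb := mem_of_subset_biUnion (blockAt_nonempty S) (blockAt_disjoint S hdisj) hqb
    have hlt' : (⟨i, a⟩ : BlockIndex S) < ⟨i, b⟩ := Sigma.mk_lt_mk_iff.mpr hab
    by_contra hcon
    have hle : (q : ℕ) ≤ p := not_lt.mp hcon
    rcases hle.eq_or_lt with heq | hqp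
    · have hpq : L[(q : ℕ)] = L[(p : ℕ)] := by simp only [heq]
      exact hanti _ (List.getElem_mem hp) _ ha _ (hpq ▸ hb) hlt'
    · exact List.pairwise_iff_getElem.mp hlt q p hq hp hqp _ hb _ ha hlt'
  · rw [List.map_map]
    exact List.map_id'' hparts L

theorem IsShuffleLumping.tailsNonpos_iff (hdisj : ∀ i j, i ≠ j → Disjoint (J i) (J j))
    {T : OrderedSetPartition (Finset.univ : Finset (Fin n))} (hT : IsShuffleLumping S T)
    (x : Fin n → ℝ) (hx : ∑ i, x i = 0) :
    TailsNonpos (fun p => ∑ k ∈ blockAt S p, x k) (T.blocks.map (partsOf (blockAt S))) ↔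
      x ∈ T.plate := by
  have key : ∀ j, ∑ p ∈ listUnion ((T.blocks.map (partsOf (blockAt S))).drop j),
      ∑ k ∈ blockAt S p, x k = - ∑ k ∈ T.initialUnion j, x k := by
    intro j
    have hs := T.sum_initialUnion_add_sum_drop x j
    rw [← sum_biUnion_blockAt S hdisj, ← List.map_drop,
      hT.listUnion_map_partsOf fun B hB => List.mem_of_mem_drop hB]
    linarith
  simp only [TailsNonpos, key, List.length_map, neg_nonpos]
  constructor
  · exact fun h => ⟨fun i hi => absurd (Finset.mem_univ i) hi, hx,
      fun j h1 h2 => h j h1 h2.le⟩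
  · intro h j h1 h2
    rcases h2.eq_or_lt with rfl | h2
    -- `TailsNonpos` also includes the empty tail, a case that the plate omits; there the initial
    -- union is everything and has sum zero.
    · have := T.initialUnion_len
      rw [len] at this
      rw [this, hx]
    · exact h.2.2 j h1 h2

end Family

end OrderedSetPartition

/-- Since `-1` is its own inverse, the integer exponent of the theorem turns into the natural one
used for layerings. -/
theorem neg_one_zpow_natCast_sub_natCast {R : Type*} [DivisionRing R] (a b : ℕ) :
    (-1 : R) ^ ((a : ℤ) - (b : ℤ)) = (-1) ^ (a + b) := by
  rw [zpow_sub₀ (neg_ne_zero.mpr one_ne_zero), zpow_natCast, zpow_natCast, pow_add,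
    div_eq_mul_inv, ← inv_pow, inv_neg, inv_one]

open OrderedSetPartition in
theorem theorem3p9 {n l : ℕ} (hn : 1 ≤ n) (J : Fin l → Finset (Fin n))
    (hdisj : ∀ i j, i ≠ j → Disjoint (J i) (J j))
    (hunion : Finset.univ.biUnion J = Finset.univ)
    (S : ∀ i, OrderedSetPartition (J i)) :
    convolution (fun i => (S i).plate) =
      ∑ T ∈ OrderedSetPartition.shuffleLumpings S,
        (-1 : ℂ) ^ (((∑ i, (S i).len : ℕ) : ℤ) - (T.len : ℤ)) • charFn T.plate := by
  classical
  funext x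
  simp only [convolution, Finset.sum_apply, Pi.smul_apply, smul_eq_mul, charFn,
    Set.indicator_apply]
  by_cases hx : ∑ i, x i = 0
  · have hy : ∑ p : BlockIndex S, ∑ k ∈ blockAt S p, x k = 0 := by
      rw [← sum_biUnion_blockAt S hdisj, ← hx]
      refine Finset.sum_congr (Finset.eq_univ_of_forall fun i => ?_) fun _ _ => rfl
      obtain ⟨p, hp⟩ := exists_mem_blockAt S hunion i
      exact Finset.mem_biUnion.mpr ⟨p, Finset.mem_univ p, hp⟩
    have hmain := sum_layerings_tailsNonpos (fun p : BlockIndex S => ∑ k ∈ blockAt S p, x k)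
      Finset.univ hy.le
    simp only [mem_sum_plate_iff_upperNonpos S hdisj hunion x hx]
    rw [← hmain]
    symm
    have hmem : ∀ {T}, T ∈ shuffleLumpings S ↔ IsShuffleLumping S T := by
      simp [shuffleLumpings]
    -- The bijection records, for each block of `T`, which blocks of the `S i` it lumps together.
    refine Finset.sum_nbij (fun T => T.blocks.map (partsOf (blockAt S))) ?_ ?_ ?_ ?_
    · exact fun T hT => (hmem.mp hT).map_partsOf_mem_layerings hdisj
    · intro T hT T' hT' h
      have hrec : ∀ T ∈ shuffleLumpings S, (T.blocks.map (partsOf (blockAt S))).map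
          (fun A => A.biUnion (blockAt S)) = T.blocks := fun T hT => by
        rw [List.map_map]
        exact (List.map_congr_left fun B hB => (hmem.mp hT).biUnion_partsOf hB).trans
          (List.map_id' T.blocks)
      exact OrderedSetPartition.ext ((hrec T hT).symm.trans ((congrArg _ h).trans (hrec T' hT')))
    · intro L hL
      obtain ⟨T, hT, rfl⟩ := exists_isShuffleLumping_of_mem_layerings hdisj hunion hL
      exact ⟨T, hmem.mpr hT, rfl⟩
    · intro T hT
      simp only [(hmem.mp hT).tailsNonpos_iff hdisj x hx]
      rw [neg_one_zpow_natCast_sub_natCast, List.length_map, Finset.card_univ,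
        Fintype.card_sigma]
      simp only [Fintype.card_fin]
      rfl
  · rw [if_neg]
    · refine (Finset.sum_eq_zero fun T _ => ?_).symm
      rw [if_neg fun h => hx h.2.1, mul_zero]
    · intro h
      rw [mem_sum_plate S hdisj hunion] at h
      refine hx ?_
      rw [← hunion, Finset.sum_biUnion fun i _ j _ hij => hdisj i j hij]
      exact Finset.sum_eq_zero fun i _ => (h i).1
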